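/- Let $X$ be a complex Banach space and $L(X)$ the algebra of bounded linear operators on $X$. An operator $S\in L(X)$ is called meromorphic if $0$ is the only possible accumulation point of the spectrum $\sigma(S)$ and every non-zero isolated point of $\sigma(S)$ is a pole of the resolvent $\mu\mapsto (S-\mu I)^{-1}$. It is called polynomially meromorphic if there is a non-constant complex polynomial $P$ such that $P(S)$ is meromorphic. An operator $T\in L(X)$ has a generalized meromorphic resolvent if there is a $\lambda$ in its resolvent set $\rho(T)$ such that $(T-\lambda I)^{-1}$ is polynomially meromorphic. Theorem. Let $T\in L(X)$ have a generalized meromorphic resolvent. Then for all $\lambda\in\rho(T)$, $(T-\lambda I)^{-1}$ is a polynomially meromorphic operator. -/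

import Mathlib

open Filter Topology

/-- `z` is a pole of the resolvent of `T`: an isolated point of the spectrum of `T` at which the
operator-valued function `μ ↦ (μ - T)⁻¹`, defined near `z` off `z`, has a pole, that is, it is
meromorphic at `z` with negative order. (The resolvent `μ ↦ (T - μ)⁻¹` is its negative, with the
same poles.) -/
def IsResolventPole {X : Type*} [NormedAddCommGroup X] [NormedSpace ℂ X]
    (T : X →L[ℂ] X) (z : ℂ) : Prop :=
  z ∈ spectrum ℂ T ∧ ¬ AccPt z (𝓟 (spectrum ℂ T)) ∧
    MeromorphicAt (fun μ : ℂ => resolvent T μ) z ∧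
    meromorphicOrderAt (fun μ : ℂ => resolvent T μ) z < 0

/-- A bounded operator is meromorphic if `0` is the only possible accumulation point of its
spectrum and every non-zero isolated point of the spectrum is a pole of the resolvent. -/
def IsMeromorphicOperator {X : Type*} [NormedAddCommGroup X] [NormedSpace ℂ X]
    (T : X →L[ℂ] X) : Prop :=
  (∀ z : ℂ, AccPt z (𝓟 (spectrum ℂ T)) → z = 0) ∧
    ∀ z ∈ spectrum ℂ T, z ≠ 0 → ¬ AccPt z (𝓟 (spectrum ℂ T)) → IsResolventPole T z

/-- A bounded operator `T` is polynomially meromorphic if `P(T)` is meromorphic for some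
non-constant complex polynomial `P`. (For a constant polynomial `P`, the operator `P(T)` is a scalar
operator, which is always meromorphic.) -/
def IsPolynomiallyMeromorphic {X : Type*} [NormedAddCommGroup X] [NormedSpace ℂ X]
    (T : X →L[ℂ] X) : Prop :=
  ∃ P : Polynomial ℂ, 0 < P.natDegree ∧ IsMeromorphicOperator (Polynomial.aeval T P)

/-- `T` has a generalized meromorphic resolvent if `(T - l)⁻¹` is polynomially meromorphic
for some `l` in the resolvent set. (At such `l` the operator `T - l` is a unit, and
`Ring.inverse` is its genuine inverse.) -/
def HasGeneralizedMeromorphicResolvent {X : Type*} [NormedAddCommGroup X] [NormedSpace ℂ X]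
    (T : X →L[ℂ] X) : Prop :=
  ∃ l ∈ resolventSet ℂ T,
    IsPolynomiallyMeromorphic (Ring.inverse (T - l • (1 : X →L[ℂ] X)))

/-! An operator `a` is meromorphic exactly when `a - z` is strongly π-regular (Drazin invertible)
for every `z ≠ 0`; this removes analysis from the problem. If `P(s)` is meromorphic, then `s - z` is
π-regular whenever `P(z) ≠ 0`, because `s - z` occurs in `P(s) - P(z)` to some power times a coprime
factor. The inverses `s` of `T - l₀` and `s'` of `T - l` are related by a Möbius map, so `s' - z` is
π-regular away from the images of the zeros of `P`. If `Q` vanishes at these images, then `Q(s') -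
w` with `w ≠ 0` is a product of a unit and π-regular factors, so `Q(s')` is meromorphic.

The algebra needs a commutative ring: the bicommutant of `T`. Hence the π-regularity witnesses drawn
from poles must commute with the whole commutant. -/

/-- `x` is strongly π-regular, with a witness in the bicommutant of `x`. -/
def IsBicommutantPiRegular {R : Type*} [Monoid R] (x : R) : Prop :=
  ∃ (n : ℕ) (c : R), (∀ y, Commute x y → Commute c y) ∧ x ^ n = x ^ (n + 1) * c

/-- `x` is strongly π-regular: some power `x ^ n` is a multiple of `x ^ (n + 1)`, by an element
commuting with `x`. -/
def IsPiRegular {R : Type*} [Monoid R] (x : R) : Prop :=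
  ∃ (n : ℕ) (c : R), Commute c x ∧ x ^ n = x ^ (n + 1) * c

theorem Commute.ringInverse_left {R : Type*} [MonoidWithZero R] {x y : R} (h : Commute x y) :
    Commute (Ring.inverse x) y := by
  by_cases hx : IsUnit x
  · obtain ⟨u, rfl⟩ := hx
    rw [Ring.inverse_unit]
    exact h.units_inv_left
  · rw [Ring.inverse_non_unit _ hx]
    exact Commute.zero_left y

theorem IsUnit.isBicommutantPiRegular {R : Type*} [Monoid R] {x : R} (hx : IsUnit x) :
    IsBicommutantPiRegular x := by
  obtain ⟨u, rfl⟩ := hx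
  exact ⟨0, ↑u⁻¹, fun y hy => hy.units_inv_left, by simp⟩

/-- A strongly π-regular element has a Drazin inverse. -/
theorem IsPiRegular.exists_drazin_inverse {R : Type*} [Monoid R] {b : R}
    (hb : IsPiRegular b) :
    ∃ (n : ℕ) (d : R), Commute b d ∧ b * d * d = d ∧ b ^ n * (b * d) = b ^ n := by
  obtain ⟨n, c, hcb, h⟩ := hb
  have key : ∀ k, b ^ (n + k) * c ^ k = b ^ n := by
    intro k
    induction k with
    | zero => simp
    | succ k ih =>
      calc b ^ (n + (k + 1)) * c ^ (k + 1) = b ^ k * (b ^ (n + 1) * c) * c ^ k := by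
            rw [pow_succ' c, show n + (k + 1) = k + (n + 1) by ring, pow_add]
            simp only [mul_assoc]
        _ = b ^ n := by rw [← h, ← pow_add, add_comm k n, ih]
  have hbd : b * (b ^ n * c ^ (n + 1)) = b ^ n * c ^ n := by
    rw [← mul_assoc, ← pow_succ', pow_succ' c, ← mul_assoc, ← h]
  have hbe : b ^ n * (b ^ n * c ^ n) = b ^ n := by rw [← mul_assoc, ← pow_add, key]
  refine ⟨n, b ^ n * c ^ (n + 1), ?_, ?_, ?_⟩
  · exact ((Commute.refl b).pow_right n).mul_right (hcb.symm.pow_right _)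
  · calc b * (b ^ n * c ^ (n + 1)) * (b ^ n * c ^ (n + 1))
        = c ^ n * (b ^ n * (b ^ n * c ^ n)) * c := by
          rw [hbd, (hcb.symm.pow_pow n n).eq, pow_succ c]
          simp only [mul_assoc]
          rw [← mul_assoc (b ^ n) (c ^ n) c, (hcb.symm.pow_pow n n).eq, mul_assoc]
      _ = b ^ n * c ^ (n + 1) := by
          rw [hbe, (hcb.pow_pow n n).eq, mul_assoc, ← pow_succ]
  · rw [hbd, hbe]

/-! ### Poles of the resolvent and π-regularity. -/

section Analytic

variable {A : Type*} [NormedRing A] [NormedAlgebra ℂ A]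

theorem commute_algebraMap_sub_iff {a y : A} {z : ℂ} :
    Commute (a - algebraMap ℂ A z) y ↔ Commute a y := by
  constructor
  · intro h
    simpa using h.add_left (Algebra.commutes z y : Commute (algebraMap ℂ A z) y)
  · intro h
    exact h.sub_left (Algebra.commutes z y)

/-- An analytic solution `F` of `(μ - a) F(μ) = x` near `z` makes `x` divisible by every power
of `a - z`. -/
theorem exists_eq_pow_mul_of_analyticAt (a : A) (z : ℂ) (k : ℕ) :
    ∀ (F : ℂ → A) (x : A), AnalyticAt ℂ F z →
      (∀ᶠ μ in 𝓝[≠] z, (algebraMap ℂ A μ - a) * F μ = x) →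
      (∀ y, Commute a y → ∀ᶠ μ in 𝓝[≠] z, Commute (F μ) y) →
      (∀ y, Commute a y → Commute x y) →
      ∃ c, (∀ y, Commute a y → Commute c y) ∧ x = (a - algebraMap ℂ A z) ^ k * c := by
  induction k with
  | zero => exact fun F x _ _ _ hx => ⟨x, hx, by simp⟩
  | succ k ih =>
    intro F x hF hFx hFc hx
    have hlim : Tendsto F (𝓝[≠] z) (𝓝 (F z)) := hF.continuousAt.continuousWithinAt
    have hFz : (algebraMap ℂ A z - a) * F z = x := by
      have h1 : Tendsto (fun μ => (algebraMap ℂ A μ - a) * F μ) (𝓝[≠] z)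
          (𝓝 ((algebraMap ℂ A z - a) * F z)) := by
        refine Tendsto.mul ?_ hlim
        exact ((continuous_algebraMap ℂ A).sub continuous_const).continuousAt.continuousWithinAt
      exact tendsto_nhds_unique h1 (tendsto_const_nhds.congr' (hFx.mono fun _ h => h.symm))
    have hFzc : ∀ y, Commute a y → Commute (F z) y := fun y hy =>
      tendsto_nhds_unique_of_eventuallyEq (hlim.mul_const y) (hlim.const_mul y) (hFc y hy)
    obtain ⟨p, hp⟩ := hF
    -- The difference quotient solves the same equation with right side `-F z`, which lets the
    -- induction divide again.
    have hG : AnalyticAt ℂ (dslope F z) z := ⟨_, hp.has_fpower_series_dslope_fslope⟩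
    have hGx : ∀ᶠ μ in 𝓝[≠] z, (algebraMap ℂ A μ - a) * dslope F z μ = -F z := by
      filter_upwards [hFx, self_mem_nhdsWithin] with μ hμ hne
      have hne' : μ - z ≠ 0 := sub_ne_zero.2 hne
      rw [dslope_of_ne _ hne, slope_def_module, mul_smul_comm, mul_sub, hμ, ← hFz, ← sub_mul,
        sub_sub_sub_cancel_right, ← map_sub, ← Algebra.smul_def, smul_smul, ← neg_sub μ z,
        mul_neg, inv_mul_cancel₀ hne', neg_one_smul]
    have hGc : ∀ y, Commute a y → ∀ᶠ μ in 𝓝[≠] z, Commute (dslope F z μ) y := by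
      intro y hy
      filter_upwards [hFc y hy, self_mem_nhdsWithin] with μ hμ hne
      rw [dslope_of_ne _ hne, slope_def_module]
      exact (hμ.sub_left (hFzc y hy)).smul_left _
    obtain ⟨c, hc, hcx⟩ := ih (dslope F z) (-F z) hG hGx hGc fun y hy => (hFzc y hy).neg_left
    refine ⟨c, hc, ?_⟩
    rw [pow_succ', mul_assoc, ← hcx, ← hFz, mul_neg, ← neg_mul, neg_sub]

theorem eventually_mem_resolventSet {a : A} {z : ℂ} (h : ¬ AccPt z (𝓟 (spectrum ℂ a))) :
    ∀ᶠ μ in 𝓝[≠] z, μ ∈ resolventSet ℂ a := by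
  rw [accPt_iff_frequently_nhdsNE, not_frequently] at h
  exact h.mono fun μ hμ => not_not.1 hμ

theorem commute_resolvent {a y : A} {μ : ℂ} (h : Commute a y) : Commute (resolvent a μ) y :=
  Commute.ringInverse_left ((Algebra.commute_algebraMap_left μ y).sub_left h)

theorem isBicommutantPiRegular_sub_of_meromorphicAt_resolvent {a : A} {z : ℂ}
    (h : ¬ AccPt z (𝓟 (spectrum ℂ a))) (hm : MeromorphicAt (fun μ : ℂ => resolvent a μ) z) :
    IsBicommutantPiRegular (a - algebraMap ℂ A z) := by
  obtain ⟨n, hn⟩ := hm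
  set b := a - algebraMap ℂ A z with hb
  have hq : AnalyticAt ℂ (fun μ : ℂ => ∑ i ∈ Finset.range n, (μ - z) ^ i • b ^ (n - 1 - i)) z := by
    fun_prop
  have hbc : ∀ y, Commute a y → Commute b y := fun y hy => commute_algebraMap_sub_iff.2 hy
  -- Subtracting the geometric sum turns the right side `(μ - z) ^ n` into the constant `b ^ n`.
  set F : ℂ → A := fun μ => (μ - z) ^ n • resolvent a μ -
    ∑ i ∈ Finset.range n, (μ - z) ^ i • b ^ (n - 1 - i) with hF
  have hFx : ∀ᶠ μ in 𝓝[≠] z, (algebraMap ℂ A μ - a) * F μ = b ^ n := by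
    filter_upwards [eventually_mem_resolventSet h] with μ hμ
    have h1 : (algebraMap ℂ A μ - a) * resolvent a μ = 1 := Ring.mul_inverse_cancel _ hμ
    have h2 := (Algebra.commute_algebraMap_left (μ - z) b).mul_geom_sum₂ n
    have h3 : algebraMap ℂ A μ - a = algebraMap ℂ A (μ - z) - b := by
      rw [hb, map_sub]; abel
    simp only [hF, mul_sub, mul_smul_comm, h1]
    simp only [← map_pow, ← Algebra.smul_def] at h2
    rw [h3, h2, Algebra.algebraMap_eq_smul_one]
    abel
  have hFc : ∀ y, Commute a y → ∀ᶠ μ in 𝓝[≠] z, Commute (F μ) y := by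
    intro y hy
    refine Eventually.of_forall fun μ => ?_
    refine ((commute_resolvent hy).smul_left _).sub_left (Commute.sum_left _ _ _ fun i _ => ?_)
    exact ((hbc y hy).pow_left _).smul_left _
  obtain ⟨c, hc, hcx⟩ := exists_eq_pow_mul_of_analyticAt a z (n + 1) F (b ^ n) (hn.sub hq) hFx hFc
    fun y hy => (hbc y hy).pow_left n
  exact ⟨n, c, fun y hy => hc y (commute_algebraMap_sub_iff.1 hy), hcx⟩

theorem IsPiRegular.eventually_resolvent_eq [CompleteSpace A] {a : A} {z : ℂ}
    (h : IsPiRegular (a - algebraMap ℂ A z)) :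
    ∃ F : ℂ → A, MeromorphicAt F z ∧
      ∀ᶠ μ in 𝓝[≠] z, μ ∈ resolventSet ℂ a ∧ resolvent a μ = F μ := by
  obtain ⟨n, d, hbd, hdd, hn⟩ := h.exists_drazin_inverse
  set b := a - algebraMap ℂ A z with hb
  have hinv : AnalyticAt ℂ (fun μ : ℂ => Ring.inverse (1 - (μ - z) • d)) z := by
    have h0 : AnalyticAt ℂ (fun x : A => Ring.inverse (1 - x)) ((z - z) • d) := by
      simpa using analyticAt_inverse_one_sub ℂ A
    exact h0.comp (f := fun μ : ℂ => (μ - z) • d) (by fun_prop)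
  have hunit : ∀ᶠ μ in 𝓝 z, IsUnit (1 - (μ - z) • d) := by
    have hcont : ContinuousAt (fun μ : ℂ => 1 - (μ - z) • d) z := by fun_prop
    exact hcont.eventually_mem (by simpa using Units.nhds (1 : Aˣ))
  -- The idempotent `b * d` splits the resolvent: on its range `b` has inverse `d`, giving a
  -- Neumann-type term; on its kernel `b` is nilpotent, giving a finite sum.
  refine ⟨fun μ => -(d * Ring.inverse (1 - (μ - z) • d)) +
    ((μ - z) ^ n)⁻¹ • ((∑ i ∈ Finset.range n, (μ - z) ^ i • b ^ (n - 1 - i)) * (1 - b * d)),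
    ?_, ?_⟩
  · refine MeromorphicAt.add (AnalyticAt.meromorphicAt ?_) (MeromorphicAt.fun_smul ?_ ?_)
    · exact (analyticAt_const.mul hinv).neg
    · exact MeromorphicAt.inv (AnalyticAt.meromorphicAt (by fun_prop))
    · exact AnalyticAt.meromorphicAt (by fun_prop)
  · filter_upwards [hunit.filter_mono nhdsWithin_le_nhds, self_mem_nhdsWithin] with μ hμ hne
    have hne' : (μ - z) ^ n ≠ 0 := pow_ne_zero _ (sub_ne_zero.2 hne)
    have h3 : algebraMap ℂ A μ - a = algebraMap ℂ A (μ - z) - b := by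
      rw [hb, map_sub]; abel
    set w := μ - z
    have hwb : Commute (algebraMap ℂ A w) b := Algebra.commutes w b
    have h2 := hwb.mul_geom_sum₂ n
    simp only [← map_pow, ← Algebra.smul_def] at h2
    set q := ∑ i ∈ Finset.range n, w ^ i • b ^ (n - 1 - i) with hq
    set v := Ring.inverse (1 - w • d) with hv
    have hvu : (1 - w • d) * v = 1 := Ring.mul_inverse_cancel _ hμ
    have hbv : Commute b v :=
      (Commute.ringInverse_left ((Commute.one_left b).sub_left (hbd.symm.smul_left w))).symm
    have hbq : Commute b q :=
      Commute.sum_right _ _ _ fun i _ => ((Commute.refl b).pow_right _).smul_right _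
    have hbF : Commute b (-(d * v) + (w ^ n)⁻¹ • (q * (1 - b * d))) :=
      (hbd.mul_right hbv).neg_right.add_right ((hbq.mul_right ((Commute.one_right b).sub_right
        ((Commute.refl b).mul_right hbd))).smul_right _)
    have hr : (algebraMap ℂ A w - b) * (-(d * v) + (w ^ n)⁻¹ • (q * (1 - b * d))) = 1 := by
      have e1 : (algebraMap ℂ A w - b) * -(d * v) = b * d := by
        calc (algebraMap ℂ A w - b) * -(d * v) = (b * d - w • (b * d * d)) * v := by
              rw [hdd, Algebra.smul_def]; noncomm_ring
          _ = b * d * ((1 - w • d) * v) := by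
              rw [← mul_smul_comm, ← mul_assoc]; congr 1; noncomm_ring
          _ = b * d := by rw [hvu, mul_one]
      have e2 : (algebraMap ℂ A w - b) * (q * (1 - b * d)) = w ^ n • (1 - b * d) := by
        rw [← mul_assoc, h2, sub_mul, mul_sub (b ^ n), hn, mul_one, sub_self, sub_zero,
          Algebra.smul_def]
      rw [mul_add, e1, mul_smul_comm, e2, smul_smul, inv_mul_cancel₀ hne', one_smul]
      abel
    have hl : (-(d * v) + (w ^ n)⁻¹ • (q * (1 - b * d))) * (algebraMap ℂ A w - b) = 1 := by
      rw [((Algebra.commute_algebraMap_left w _).sub_left hbF).eq.symm, hr]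
    have hu : (algebraMap ℂ A μ - a) =
        ((⟨_, _, hr, hl⟩ : Aˣ) : A) := h3
    refine ⟨?_, ?_⟩
    · rw [spectrum.mem_resolventSet_iff, hu]; exact Units.isUnit _
    · rw [resolvent, hu, Ring.inverse_unit]; rfl

end Analytic

/-! ### Meromorphic operators in terms of π-regularity. -/

theorem IsMeromorphicOperator.isBicommutantPiRegular_sub {X : Type*} [NormedAddCommGroup X]
    [NormedSpace ℂ X] {a : X →L[ℂ] X} (ha : IsMeromorphicOperator a) {z : ℂ} (hz : z ≠ 0) :
    IsBicommutantPiRegular (a - algebraMap ℂ (X →L[ℂ] X) z) := by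
  by_cases hs : z ∈ spectrum ℂ a
  · have h := ha.2 z hs hz fun h => hz (ha.1 z h)
    exact isBicommutantPiRegular_sub_of_meromorphicAt_resolvent h.2.1 h.2.2.1
  · refine IsUnit.isBicommutantPiRegular ?_
    rw [spectrum.notMem_iff] at hs
    simpa using hs.neg

theorem isMeromorphicOperator_of_isPiRegular_sub {X : Type*} [NormedAddCommGroup X]
    [NormedSpace ℂ X] [CompleteSpace X] {a : X →L[ℂ] X}
    (h : ∀ z : ℂ, z ≠ 0 → IsPiRegular (a - algebraMap ℂ (X →L[ℂ] X) z)) :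
    IsMeromorphicOperator a := by
  refine ⟨fun z hz => ?_, fun z hs hz hacc => ⟨hs, hacc, ?_⟩⟩
  · by_contra hne
    obtain ⟨F, -, hF⟩ := (h z hne).eventually_resolvent_eq
    rw [accPt_iff_frequently_nhdsNE] at hz
    exact hz (hF.mono fun μ hμ hs => hs hμ.1)
  · obtain ⟨F, hF, hFe⟩ := (h z hz).eventually_resolvent_eq
    have hm : MeromorphicAt (fun μ : ℂ => resolvent a μ) z :=
      hF.congr (hFe.mono fun μ hμ => hμ.2.symm)
    refine ⟨hm, ?_⟩
    -- With order at least `0` the resolvent has a limit at `z`, which would invert `z - a`.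
    by_contra! hneg
    obtain ⟨L, hL⟩ := (tendsto_nhds_iff_meromorphicOrderAt_nonneg hm).2 hneg
    have hA : Tendsto (fun μ => algebraMap ℂ (X →L[ℂ] X) μ - a) (𝓝[≠] z)
        (𝓝 (algebraMap ℂ (X →L[ℂ] X) z - a)) :=
      ((continuous_algebraMap ℂ (X →L[ℂ] X)).sub
        continuous_const).continuousAt.continuousWithinAt
    have e1 := tendsto_nhds_unique_of_eventuallyEq (hA.mul hL)
      (tendsto_const_nhds (x := (1 : X →L[ℂ] X)))
      (hFe.mono fun μ hμ => Ring.mul_inverse_cancel _ hμ.1)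
    have e2 := tendsto_nhds_unique_of_eventuallyEq (hL.mul hA)
      (tendsto_const_nhds (x := (1 : X →L[ℂ] X)))
      (hFe.mono fun μ hμ => Ring.inverse_mul_cancel _ hμ.1)
    exact hs (⟨⟨_, L, e1, e2⟩, rfl⟩ : IsUnit _)

/-! ### π-regular elements of a commutative ring. -/

section Commutative

variable {B : Type*} [CommRing B]

theorem IsUnit.isPiRegular {x : B} (hx : IsUnit x) : IsPiRegular x := by
  obtain ⟨u, rfl⟩ := hx
  exact ⟨0, ↑u⁻¹, Commute.all _ _, by simp⟩

theorem IsPiRegular.pow_eq_of_le {x c : B} {n m : ℕ} (h : x ^ n = x ^ (n + 1) * c) (hm : n ≤ m) :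
    x ^ m = x ^ (m + 1) * c := by
  obtain ⟨k, rfl⟩ := Nat.exists_eq_add_of_le hm
  rw [pow_add, h]
  ring

theorem IsPiRegular.mul {x y : B} (hx : IsPiRegular x) (hy : IsPiRegular y) :
    IsPiRegular (x * y) := by
  obtain ⟨n, c, -, hc⟩ := hx
  obtain ⟨m, d, -, hd⟩ := hy
  refine ⟨n + m, c * d, Commute.all _ _, ?_⟩
  rw [mul_pow, pow_eq_of_le hc (Nat.le_add_right n m), pow_eq_of_le hd (Nat.le_add_left m n)]
  ring

theorem IsPiRegular.multiset_prod {s : Multiset B} (h : ∀ x ∈ s, IsPiRegular x) :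
    IsPiRegular s.prod :=
  Multiset.prod_induction IsPiRegular s (fun _ _ => IsPiRegular.mul) isUnit_one.isPiRegular h

theorem IsPiRegular.of_pow {x : B} {k : ℕ} (hk : k ≠ 0) (h : IsPiRegular (x ^ k)) :
    IsPiRegular x := by
  obtain ⟨n, c, -, hc⟩ := h
  obtain ⟨k, rfl⟩ := Nat.exists_eq_add_one_of_ne_zero hk
  refine ⟨(k + 1) * n, x ^ k * c, Commute.all _ _, ?_⟩
  rw [pow_mul, hc]
  ring

/-- A Bézout relation between `x` and `y ^ n` reduces `x ^ n` to a multiple of `x ^ (n + 1)` plus a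
multiple of `(x * y) ^ n`. -/
theorem IsPiRegular.of_mul_of_isCoprime {x y : B} (hxy : IsCoprime x y)
    (h : IsPiRegular (x * y)) : IsPiRegular x := by
  obtain ⟨n, c, -, hc⟩ := h
  obtain ⟨u, v, huv⟩ := hxy.pow_right (n := n)
  refine ⟨n, u + v * y ^ (n + 1) * c, Commute.all _ _, ?_⟩
  rw [mul_pow, mul_pow] at hc
  calc x ^ n = x ^ n * (u * x + v * y ^ n) := by rw [huv, mul_one]
    _ = x ^ (n + 1) * u + v * (x ^ n * y ^ n) := by ring
    _ = x ^ (n + 1) * (u + v * y ^ (n + 1) * c) := by rw [hc]; ring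

end Commutative

/-! ### Polynomials and change of base point. -/

section Polynomial

open Polynomial

variable {K B : Type*} [Field K] [CommRing B] [Algebra K B]

theorem IsPiRegular.sub_algebraMap_of_aeval {s : B} {P : K[X]} {z : K} (hP : 0 < P.natDegree)
    (h : IsPiRegular (aeval s P - algebraMap K B (P.eval z))) :
    IsPiRegular (s - algebraMap K B z) := by
  have hne : P - C (P.eval z) ≠ 0 := by
    intro h0
    rw [sub_eq_zero.1 h0, natDegree_C] at hP
    exact hP.false
  obtain ⟨q, hq, hdvd⟩ := exists_eq_pow_rootMultiplicity_mul_and_not_dvd _ hne z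
  have hk : (P - C (P.eval z)).rootMultiplicity z ≠ 0 :=
    ((rootMultiplicity_pos hne).2 (by simp)).ne'
  have hcop : IsCoprime ((X - C z) ^ (P - C (P.eval z)).rootMultiplicity z) q :=
    (((irreducible_X_sub_C z).coprime_iff_not_dvd).2 hdvd).pow_left
  have hs := hcop.map (aeval s : K[X] →ₐ[K] B).toRingHom
  have hq' := congrArg (aeval s) hq
  simp only [map_sub, aeval_C, map_mul, map_pow, aeval_X] at hq'
  rw [hq'] at h
  refine IsPiRegular.of_pow hk (IsPiRegular.of_mul_of_isCoprime ?_ h)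
  simpa using hs

theorem IsPiRegular.aeval_sub_algebraMap [IsAlgClosed K] {s : B} {Q : K[X]} {w : K}
    (hQ : 0 < Q.natDegree)
    (h : ∀ z, Q.eval z = w → IsPiRegular (s - algebraMap K B z)) :
    IsPiRegular (aeval s Q - algebraMap K B w) := by
  have hne : Q - C w ≠ 0 := by
    intro h0
    rw [sub_eq_zero.1 h0, natDegree_C] at hQ
    exact hQ.false
  have hf := congrArg (aeval s) (IsAlgClosed.splits (Q - C w)).eq_prod_roots
  simp only [map_sub, aeval_C, map_mul, map_multiset_prod, Multiset.map_map] at hf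
  rw [hf]
  refine IsPiRegular.mul ?_ (IsPiRegular.multiset_prod fun x hx => ?_)
  · exact ((isUnit_iff_ne_zero.2 (leadingCoeff_ne_zero.2 hne)).map (algebraMap K B)).isPiRegular
  · obtain ⟨z, hz, rfl⟩ := Multiset.mem_map.1 hx
    have hz' := (mem_roots hne).1 hz
    simpa using h z (by simpa [sub_eq_zero] using hz')

/-- Let `s` and `s'` be the inverses of `t` and `t - d`. If `P(s) - w` is π-regular for all
`w ≠ 0`, then so is `Q(s') - w`, for a suitable non-constant polynomial `Q`. -/
theorem exists_polynomial_isPiRegular_inverse_sub [IsAlgClosed K] {t s s' : B} {d : K}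
    (hs : t * s = 1) (hs' : (t - algebraMap K B d) * s' = 1) {P : K[X]} (hP : 0 < P.natDegree)
    (h : ∀ w ≠ 0, IsPiRegular (aeval s P - algebraMap K B w)) :
    ∃ Q : K[X], 0 < Q.natDegree ∧ ∀ w ≠ 0, IsPiRegular (aeval s' Q - algebraMap K B w) := by
  have hP0 : P ≠ 0 := ne_zero_of_natDegree_gt hP
  -- The roots are the solutions `z` of `z / (1 + d * z) = a`. If `d * a = 1`, division by zero
  -- gives a harmless extra root `0`.
  set M : K[X] := (P.roots.map fun a => X - C (a / (1 - d * a))).prod with hM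
  have hMm : M.Monic := monic_multiset_prod_of_monic _ _ fun a _ => monic_X_sub_C _
  have hQ : 0 < (X * M).natDegree := by
    rw [natDegree_X_mul hMm.ne_zero]; exact Nat.succ_pos _
  refine ⟨X * M, hQ, fun w hw => IsPiRegular.aeval_sub_algebraMap hQ fun z hz => ?_⟩
  -- Since `s'` inverts `t - d`, the left side is `s' * (1 + d * z - z * t)`; then `t` is factored
  -- out.
  have hid : s' - algebraMap K B z =
      s' * t * (algebraMap K B (1 + d * z) * s - algebraMap K B z) := by
    simp only [map_add, map_mul, map_one]
    linear_combination (-s' - s' * algebraMap K B d * algebraMap K B z) * hs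
      + algebraMap K B z * hs'
  have hu : IsUnit (s' * t) :=
    (IsUnit.of_mul_eq_one_right _ hs').mul (IsUnit.of_mul_eq_one _ hs)
  rw [hid]
  refine hu.isPiRegular.mul ?_
  have hQz : (X * M).eval z ≠ 0 := hz ▸ hw
  rw [eval_mul, eval_X] at hQz
  by_cases hdz : 1 + d * z = 0
  · rw [hdz, map_zero, zero_mul, zero_sub]
    exact ((isUnit_iff_ne_zero.2 (left_ne_zero_of_mul hQz)).map (algebraMap K B)).neg.isPiRegular
  · have hPz : P.eval (z / (1 + d * z)) ≠ 0 := by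
      intro h0
      refine right_ne_zero_of_mul hQz ?_
      rw [hM, eval_multiset_prod, Multiset.prod_eq_zero_iff, Multiset.map_map]
      refine Multiset.mem_map.2 ⟨_, (mem_roots hP0).2 h0, ?_⟩
      have h1 : 1 - d * (z / (1 + d * z)) = (1 + d * z)⁻¹ := by field_simp; ring
      simp [h1, hdz]
    have hreg := IsPiRegular.sub_algebraMap_of_aeval hP (h _ hPz)
    have heq : algebraMap K B (1 + d * z) * s - algebraMap K B z =
        algebraMap K B (1 + d * z) * (s - algebraMap K B (z / (1 + d * z))) := by
      rw [mul_sub, ← map_mul, mul_div_cancel₀ _ hdz]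
    rw [heq]
    exact ((isUnit_iff_ne_zero.2 hdz).map (algebraMap K B)).isPiRegular.mul hreg

end Polynomial

/-! ### The bicommutant as a commutative ring. -/

section Bicommutant

open scoped IsMulCommutative

variable (R : Type*) {A : Type*} [CommRing R] [Ring A] [Algebra R A]

/-- The bicommutant of an element. -/
def bicommutant (T : A) : Subalgebra R A :=
  Subalgebra.centralizer R (Set.centralizer {T})

variable {R}

theorem mem_bicommutant_iff {T x : A} :
    x ∈ bicommutant R T ↔ ∀ y, Commute T y → Commute x y := by
  simp only [bicommutant, Subalgebra.mem_centralizer_iff, Set.mem_centralizer_iff,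
    Set.mem_singleton_iff, forall_eq]
  exact ⟨fun h y hy => (h y hy).symm, fun h y hy => (h y hy).symm⟩

instance (T : A) : IsMulCommutative (bicommutant R T) :=
  ⟨⟨fun x y => Subtype.ext (mem_bicommutant_iff.1 x.2 y
    (mem_bicommutant_iff.1 y.2 T (Commute.refl T)).symm)⟩⟩

/-- Whatever commutes with `T` commutes with `x`, hence with the witness, which therefore lies in
the bicommutant of `T`. -/
theorem IsBicommutantPiRegular.isPiRegular {T : A} {x : bicommutant R T}
    (hx : IsBicommutantPiRegular (x : A)) : IsPiRegular x := by
  obtain ⟨n, c, hc, h⟩ := hx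
  have hcT : c ∈ bicommutant R T :=
    mem_bicommutant_iff.2 fun y hy => hc y (mem_bicommutant_iff.1 x.2 y hy)
  exact ⟨n, ⟨c, hcT⟩, Commute.all _ _, Subtype.ext (by simpa using h)⟩

theorem IsPiRegular.coe {T : A} {x : bicommutant R T} (hx : IsPiRegular x) :
    IsPiRegular (x : A) := by
  obtain ⟨n, c, hc, h⟩ := hx
  exact ⟨n, c, congrArg Subtype.val hc.eq, by simpa using congrArg Subtype.val h⟩

theorem ringInverse_mem_bicommutant {T x : A} (hx : x ∈ bicommutant R T) :
    Ring.inverse x ∈ bicommutant R T :=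
  mem_bicommutant_iff.2 fun y hy => (mem_bicommutant_iff.1 hx y hy).ringInverse_left

end Bicommutant

theorem mainTheorem12 {X : Type*} [NormedAddCommGroup X] [NormedSpace ℂ X] [CompleteSpace X]
    (T : X →L[ℂ] X) (hT : HasGeneralizedMeromorphicResolvent T) :
    ∀ l ∈ resolventSet ℂ T,
      IsPolynomiallyMeromorphic (Ring.inverse (T - l • (1 : X →L[ℂ] X))) := by
  open scoped IsMulCommutative in
  intro l hl
  obtain ⟨l₀, hl₀, P, hP, hmer⟩ := hT
  have hunit : ∀ z ∈ resolventSet ℂ T, IsUnit (T - z • (1 : X →L[ℂ] X)) := fun z hz => by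
    rw [spectrum.mem_resolventSet_iff, Algebra.algebraMap_eq_smul_one] at hz
    simpa using hz.neg
  have hTB : T ∈ bicommutant ℂ T := mem_bicommutant_iff.2 fun _ h => h
  have hmem : ∀ z : ℂ, T - z • (1 : X →L[ℂ] X) ∈ bicommutant ℂ T := fun z =>
    sub_mem hTB (Subalgebra.smul_mem _ (one_mem _) z)
  let t : bicommutant ℂ T := ⟨_, hmem l₀⟩
  let s : bicommutant ℂ T := ⟨_, ringInverse_mem_bicommutant (hmem l₀)⟩
  let s' : bicommutant ℂ T := ⟨_, ringInverse_mem_bicommutant (hmem l)⟩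
  have hs : t * s = 1 := Subtype.ext (Ring.mul_inverse_cancel _ (hunit l₀ hl₀))
  have hs' : (t - algebraMap ℂ (bicommutant ℂ T) (l - l₀)) * s' = 1 := by
    refine Subtype.ext (Eq.trans ?_ (Ring.mul_inverse_cancel _ (hunit l hl)))
    change (T - l₀ • (1 : X →L[ℂ] X) - algebraMap ℂ (X →L[ℂ] X) (l - l₀)) *
      Ring.inverse (T - l • (1 : X →L[ℂ] X)) = _
    rw [Algebra.algebraMap_eq_smul_one, sub_smul, sub_sub_sub_cancel_right]
  have hcoe : ∀ (x : bicommutant ℂ T) (Q : Polynomial ℂ) (w : ℂ),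
      ((Polynomial.aeval x Q - algebraMap ℂ (bicommutant ℂ T) w : bicommutant ℂ T) :
        X →L[ℂ] X) = Polynomial.aeval (x : X →L[ℂ] X) Q - algebraMap ℂ (X →L[ℂ] X) w := by
    intro x Q w
    exact congrArg (· - algebraMap ℂ (X →L[ℂ] X) w)
      (Polynomial.aeval_algHom_apply (bicommutant ℂ T).val x Q).symm
  obtain ⟨Q, hQ, h⟩ := exists_polynomial_isPiRegular_inverse_sub hs hs' hP fun w hw =>
    IsBicommutantPiRegular.isPiRegular (by
      rw [hcoe]
      exact hmer.isBicommutantPiRegular_sub hw)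
  refine ⟨Q, hQ, isMeromorphicOperator_of_isPiRegular_sub fun w hw => ?_⟩
  have := (h w hw).coe
  rwa [hcoe] at this
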